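/- Let $0<\gamma\le 1$ and $c>0$, and set $\alpha=(1-\gamma)/\gamma$. There exists a constant $c_1=c_1(\gamma,c)>0$, depending only on $\gamma$ and $c$, such that the following holds. Let $G=(V,E)$ be an infinite, connected, locally finite (simple) graph, let $(X_k)_{k\ge 0}$ denote simple random walk on $G$, and let $p_n(u,v)$ be its $n$-step transition probabilities. Suppose that $G$ satisfies $$(\mathrm{HK}_{\gamma,c})\qquad p_n(v,v)\le \exp\left[-c\,n^{\gamma}\right]\quad\text{for every } v\in V \text{ and every integer } n\ge 1 .$$ Then for every finite non-empty set $D\subset V$ and every integer $k\ge 0$, the walk started at a uniformly random vertex of $D$ (with law denoted $\mathbf P_{\mu_D}$, where $\mu_D$ is the uniform measure on $D$) satisfies $$\mathbf P_{\mu_D}(X_k\in D)\le\left[\max_{u,v\in D}\frac{\deg(u)}{\deg(v)}\right]^{1/2}\exp\left[-c_1\min\left\{\frac{k}{(\log|D|)^{\alpha}},\,k^{\gamma}\right\}\right],$$ where for $|D|=1$ the minimum is read as $k^\gamma$. -/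

import Mathlib

/-- One step of simple random walk on a locally finite graph: from `v`, move to a uniformly
random neighbour of `v`. (An isolated vertex, which an infinite connected graph does not have,
is made absorbing.) -/
noncomputable def srwStep {V : Type*} (G : SimpleGraph V) [G.LocallyFinite] (v : V) : PMF V :=
  open Classical in
  if h : (G.neighborFinset v).Nonempty then PMF.uniformOfFinset (G.neighborFinset v) h
  else PMF.pure v

/-- The law of `X_k`, where `(X_k)_{k ≥ 0}` is simple random walk on `G` whose starting vertex
`X_0` is drawn from `μ`. -/
noncomputable def srwLaw {V : Type*} (G : SimpleGraph V) [G.LocallyFinite] (μ : PMF V) :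
    ℕ → PMF V
  | 0 => μ
  | k + 1 => (srwLaw G μ k).bind (srwStep G)

/-- The `n`-step transition probability `p_n(u, v)` of simple random walk on `G`. -/
noncomputable def srwTransition {V : Type*} (G : SimpleGraph V) [G.LocallyFinite]
    (n : ℕ) (u v : V) : ℝ :=
  (srwLaw G (PMF.pure u) n v).toReal

/-- The return probability condition `(HK_{γ,c})`:
`p_n(v, v) ≤ exp(- c n ^ γ)` for every vertex `v` and every `n ≥ 1`. -/
def SatisfiesHK {V : Type*} (G : SimpleGraph V) [G.LocallyFinite] (γ c : ℝ) : Prop :=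
  ∀ (v : V) (n : ℕ), 1 ≤ n → srwTransition G n v v ≤ Real.exp (-c * (n : ℝ) ^ γ)

/-- `P_{μ_D}(X_k ∈ D)`: the probability that simple random walk started at a uniformly random
vertex of the finite nonempty set `D` is in `D` at time `k`. -/
noncomputable def srwReturnProb {V : Type*} (G : SimpleGraph V) [G.LocallyFinite]
    (D : Finset V) (hD : D.Nonempty) (k : ℕ) : ℝ :=
  ((srwLaw G (PMF.uniformOfFinset D hD) k).toOuterMeasure (D : Set V)).toReal

/-- `max_{u, v ∈ D} deg u / deg v`. -/
noncomputable def maxDegreeRatio {V : Type*} (G : SimpleGraph V) [G.LocallyFinite]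
    (D : Finset V) (hD : D.Nonempty) : ℝ :=
  (D ×ˢ D).sup' (hD.product hD) fun p => (G.degree p.1 : ℝ) / (G.degree p.2 : ℝ)

/-- `min {k / log^α m, k ^ γ}` for `m ≥ 1`. When `m = 1` the logarithm vanishes, the first term
is read as `+∞`, and the minimum is `k ^ γ`. (If `α = 0` and `γ = 1`, reading `0 ^ 0` as `1`
gives the same value.) -/
noncomputable def escapeExponent (γ α : ℝ) (m k : ℕ) : ℝ :=
  if m = 1 then (k : ℝ) ^ γ
  else min ((k : ℝ) / (Real.log (m : ℝ)) ^ α) ((k : ℝ) ^ γ)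

/-! Conjugating the walk by √deg gives a symmetric kernel `q` with the same diagonal, at the cost of
the square root of the degree ratio. Put f(n) = ⟨1_D, q_n 1_D⟩ / |D|. Cauchy–Schwarz gives f(n)² ≤
f(2n), hence f(k) ≤ f(N)^(k/N) for N = 2^j k (`meanMass_pow_le`). At even times the diagonal bounds
the off-diagonal, so f(N) ≤ |D| exp(-c N^γ). Once N^γ ≥ (2/c) log |D|, half the exponent absorbs
|D|, leaving f(k) ≤ exp(-(c/2) k N^(γ-1)). The least such dyadic N is at most twice k or twice
((2/c) log |D|)^(1/γ); these two cases give the two terms of the minimum. -/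

section Escape

variable {V : Type*}

/-- A family of symmetric nonnegative kernels with the semigroup property. -/
structure IsSymmSemigroup (q : ℕ → V → V → ℝ) : Prop where
  nonneg : ∀ n u v, 0 ≤ q n u v
  symm : ∀ n u v, q n u v = q n v u
  hasSum : ∀ m n u v, HasSum (fun w => q m u w * q n w v) (q (m + n) u v)

/-- The quadratic form `⟨1_D, q_n 1_D⟩ / |D|`. -/
noncomputable def meanMass (q : ℕ → V → V → ℝ) (D : Finset V) (n : ℕ) : ℝ :=
  (D.card : ℝ)⁻¹ * ∑ u ∈ D, ∑ v ∈ D, q n u v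

namespace IsSymmSemigroup

variable {q : ℕ → V → V → ℝ}

theorem meanMass_nonneg (hq : IsSymmSemigroup q) (D : Finset V) (n : ℕ) :
    0 ≤ meanMass q D n :=
  mul_nonneg (by positivity)
    (Finset.sum_nonneg fun u _ => Finset.sum_nonneg fun v _ => hq.nonneg n u v)

/-- AM-GM, term by term in the semigroup sum. -/
theorem add_self_le (hq : IsSymmSemigroup q) (n : ℕ) (u v : V) :
    q (n + n) u v ≤ (q (n + n) u u + q (n + n) v v) / 2 := by
  refine hasSum_le (fun w => ?_) (hq.hasSum n n u v)
    (((hq.hasSum n n u u).add (hq.hasSum n n v v)).div_const 2)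
  rw [hq.symm n w v, hq.symm n w u]
  nlinarith [sq_nonneg (q n u w - q n v w)]

/-- By symmetry the right side is the squared ℓ² norm of `q_n 1_D`, divided by |D|. Restrict that
norm to D and apply Cauchy–Schwarz there. -/
theorem meanMass_sq_le (hq : IsSymmSemigroup q) (D : Finset V) (hD : D.Nonempty) (n : ℕ) :
    meanMass q D n ^ 2 ≤ meanMass q D (n + n) := by
  have hpos : (0 : ℝ) < D.card := by exact_mod_cast hD.card_pos
  have hsum : HasSum (fun w => (∑ u ∈ D, q n u w) ^ 2)
      (∑ u ∈ D, ∑ v ∈ D, q (n + n) u v) := by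
    have := hasSum_sum (s := D) fun u _ => hasSum_sum (s := D) fun v _ => hq.hasSum n n u v
    refine this.congr_fun ?_
    intro w
    rw [sq, Finset.sum_mul_sum]
    exact Finset.sum_congr rfl fun u _ => Finset.sum_congr rfl fun v _ => by rw [hq.symm n w v]
  have h1 : ∑ w ∈ D, (∑ u ∈ D, q n u w) ^ 2 ≤ ∑ u ∈ D, ∑ v ∈ D, q (n + n) u v :=
    sum_le_hasSum D (fun w _ => sq_nonneg _) hsum
  have h2 := sq_sum_le_card_mul_sum_sq (s := D) (f := fun w => ∑ u ∈ D, q n u w)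
  rw [Finset.sum_comm] at h2
  unfold meanMass
  rw [mul_pow]
  calc _ ≤ (D.card : ℝ)⁻¹ ^ 2 * (D.card * ∑ u ∈ D, ∑ v ∈ D, q (n + n) u v) := by
        gcongr
        exact h2.trans (by gcongr)
    _ = _ := by field_simp

theorem meanMass_pow_le (hq : IsSymmSemigroup q) (D : Finset V) (hD : D.Nonempty) (n j : ℕ) :
    meanMass q D n ^ 2 ^ j ≤ meanMass q D (2 ^ j * n) := by
  induction j with
  | zero => simp
  | succ j ih =>
    rw [pow_succ, pow_mul]
    calc _ ≤ meanMass q D (2 ^ j * n) ^ 2 :=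
          pow_le_pow_left₀ (pow_nonneg (hq.meanMass_nonneg D n) _) ih 2
      _ ≤ _ := hq.meanMass_sq_le D hD _
      _ = _ := by congr 1; ring

theorem meanMass_add_self_le (hq : IsSymmSemigroup q) (D : Finset V) (hD : D.Nonempty) (n : ℕ)
    {ε : ℝ} (h : ∀ v, q (n + n) v v ≤ ε) : meanMass q D (n + n) ≤ D.card * ε := by
  have hpos : (0 : ℝ) < D.card := by exact_mod_cast hD.card_pos
  have h1 : ∑ u ∈ D, ∑ v ∈ D, q (n + n) u v ≤ ∑ _u ∈ D, ∑ _v ∈ D, ε :=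
    Finset.sum_le_sum fun u _ => Finset.sum_le_sum fun v _ =>
      (hq.add_self_le n u v).trans (by linarith [h u, h v])
  simp only [Finset.sum_const, nsmul_eq_mul] at h1
  calc _ ≤ (D.card : ℝ)⁻¹ * (D.card * (D.card * ε)) := by
        unfold meanMass; gcongr
    _ = _ := by field_simp

end IsSymmSemigroup

/-! ### Choice of the time scale -/

/-- A dyadic multiple `2 ^ j * k`, `j ≥ 1`, lies above `T` but not above `max (2 k) (2 T)`. -/
theorem exists_two_pow_mul_between (k : ℕ) (hk : 1 ≤ k) (T : ℝ) :
    ∃ j : ℕ, T ≤ 2 ^ (j + 1) * (k : ℝ) ∧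
      (2 ^ (j + 1) * (k : ℝ) ≤ 2 * k ∨ 2 ^ (j + 1) * (k : ℝ) ≤ 2 * T) := by
  classical
  have hk' : (1 : ℝ) ≤ k := by exact_mod_cast hk
  have hex : ∃ j : ℕ, T ≤ 2 ^ (j + 1) * (k : ℝ) := by
    obtain ⟨j, hj⟩ := pow_unbounded_of_one_lt T (one_lt_two : (1 : ℝ) < 2)
    refine ⟨j, ?_⟩
    have : (0 : ℝ) < 2 ^ j := by positivity
    rw [pow_succ]
    nlinarith
  refine ⟨Nat.find hex, Nat.find_spec hex, ?_⟩
  rcases h : Nat.find hex with _ | i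
  · left; simp
  · right
    have := Nat.find_min hex (m := i) (by omega)
    rw [pow_succ]
    linarith

/-- Since γ - 1 ≤ 0, an upper bound on N bounds N^(γ-1) from below. -/
theorem escapeExponent_le_dyadic {γ c α : ℝ} (hγ0 : 0 < γ) (hγ1 : γ ≤ 1) (hc : 0 < c)
    (hα : α = (1 - γ) / γ) (m : ℕ) (hm : 1 ≤ m) (k : ℕ) (hk : 1 ≤ k) (N : ℝ) (hN : 0 < N)
    (h : N ≤ 2 * k ∨ N ≤ 2 * (2 * Real.log m / c) ^ (1 / γ)) :
    2 ^ (γ - 1) * min 1 ((c / 2) ^ α) * escapeExponent γ α m k ≤ k * N ^ (γ - 1) := by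
  have hk' : (0 : ℝ) < k := by exact_mod_cast hk
  have hL : 0 ≤ Real.log m := Real.log_natCast_nonneg m
  have h2 : (0 : ℝ) < 2 ^ (γ - 1) := by positivity
  have hmin : 0 ≤ min 1 ((c / 2) ^ α) := by positivity
  have he : 0 ≤ escapeExponent γ α m k := by
    unfold escapeExponent; split_ifs <;> positivity
  have hanti {x : ℝ} (hx : N ≤ x) : x ^ (γ - 1) ≤ N ^ (γ - 1) :=
    Real.rpow_le_rpow_of_nonpos hN hx (by linarith)
  rcases h with h | h
  · have h1 : escapeExponent γ α m k ≤ (k : ℝ) ^ γ := by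
      unfold escapeExponent; split_ifs
      · exact le_rfl
      · exact min_le_right _ _
    calc _ ≤ 2 ^ (γ - 1) * 1 * (k : ℝ) ^ γ := by
          gcongr; exact min_le_left _ _
      _ = k * (2 * k) ^ (γ - 1) := by
          rw [Real.mul_rpow (by norm_num) hk'.le, Real.rpow_sub_one hk'.ne']; field_simp
      _ ≤ _ := mul_le_mul_of_nonneg_left (hanti h) hk'.le
  -- For m = 1 the threshold is 0, which contradicts N > 0.
  · have hm1 : m ≠ 1 := by
      rintro rfl
      rw [Nat.cast_one, Real.log_one, mul_zero, zero_div, Real.zero_rpow (by positivity)] at h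
      linarith
    have hLpos : 0 < Real.log m := Real.log_pos (by exact_mod_cast (by omega : 1 < m))
    have h1 : escapeExponent γ α m k ≤ k / Real.log m ^ α := by
      unfold escapeExponent; rw [if_neg hm1]; exact min_le_left _ _
    have hexp : 1 / γ * (γ - 1) = -α := by rw [hα]; field_simp; ring
    calc _ ≤ 2 ^ (γ - 1) * (c / 2) ^ α * (k / Real.log m ^ α) := by
          gcongr; exact min_le_right _ _
      _ = k * (2 * (2 * Real.log m / c) ^ (1 / γ)) ^ (γ - 1) := by
          rw [Real.mul_rpow (by norm_num) (by positivity), ← Real.rpow_mul (by positivity), hexp,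
            Real.rpow_neg (by positivity), ← Real.inv_rpow (by positivity),
            show (2 * Real.log m / c)⁻¹ = (c / 2) / Real.log m by field_simp,
            Real.div_rpow (by positivity) hLpos.le]
          ring
      _ ≤ _ := mul_le_mul_of_nonneg_left (hanti h) hk'.le

theorem IsSymmSemigroup.meanMass_le_exp {q : ℕ → V → V → ℝ} (hq : IsSymmSemigroup q)
    {γ c α : ℝ} (hγ0 : 0 < γ) (hγ1 : γ ≤ 1) (hc : 0 < c) (hα : α = (1 - γ) / γ)
    (hdiag : ∀ v (n : ℕ), 1 ≤ n → q n v v ≤ Real.exp (-c * (n : ℝ) ^ γ))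
    (D : Finset V) (hD : D.Nonempty) (k : ℕ) (hk : 1 ≤ k) :
    meanMass q D k ≤ Real.exp (-(c / 2 * (2 ^ (γ - 1) * min 1 ((c / 2) ^ α))) *
      escapeExponent γ α D.card k) := by
  have hcard : (0 : ℝ) < D.card := by exact_mod_cast hD.card_pos
  have hk' : (0 : ℝ) < k := by exact_mod_cast hk
  have hL : 0 ≤ Real.log D.card := Real.log_natCast_nonneg _
  obtain ⟨j, hT, hj⟩ := exists_two_pow_mul_between k hk ((2 * Real.log D.card / c) ^ (1 / γ))
  set N : ℝ := 2 ^ (j + 1) * (k : ℝ) with hN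
  have hNpos : 0 < N := by positivity
  have hexp := escapeExponent_le_dyadic hγ0 hγ1 hc hα D.card hD.card_pos k hk N hNpos hj
  have hLN : Real.log D.card ≤ c / 2 * N ^ γ := by
    have := Real.rpow_le_rpow (by positivity) hT hγ0.le
    rw [← Real.rpow_mul (by positivity), one_div_mul_cancel hγ0.ne', Real.rpow_one,
      div_le_iff₀ hc] at this
    linarith
  have hNat : 2 ^ j * k + 2 ^ j * k = 2 ^ (j + 1) * k := by ring
  have hmass : meanMass q D (2 ^ (j + 1) * k) ≤ Real.exp (-(c / 2) * N ^ γ) := by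
    have h1 := hq.meanMass_add_self_le D hD (2 ^ j * k) (fun v => hdiag v _ (by
      have : 0 < 2 ^ j * k := by positivity
      omega))
    rw [hNat] at h1
    refine h1.trans ?_
    push_cast
    rw [← hN]
    nth_rw 1 [← Real.exp_log hcard]
    rw [← Real.exp_add, Real.exp_le_exp]
    linarith
  have hdiv : N ^ γ = 2 ^ (j + 1) * (k * N ^ (γ - 1)) := by
    rw [Real.rpow_sub_one hNpos.ne', hN]; field_simp
  have hpow : meanMass q D k ^ 2 ^ (j + 1) ≤
      Real.exp (-(c / 2) * (k * N ^ (γ - 1))) ^ 2 ^ (j + 1) := by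
    refine ((hq.meanMass_pow_le D hD k (j + 1)).trans hmass).trans_eq ?_
    rw [← Real.exp_nat_mul, hdiv]
    push_cast
    congr 1
    ring
  refine (le_of_pow_le_pow_left₀ (by positivity) (Real.exp_nonneg _) hpow).trans ?_
  rw [Real.exp_le_exp]
  have := mul_le_mul_of_nonneg_left hexp (half_pos hc).le
  linarith

/-! ### Reversibility and symmetrization of the walk -/

section Walk

open scoped ENNReal

variable (G : SimpleGraph V) [G.LocallyFinite]

theorem srwLaw_eq_bind (μ : PMF V) (n : ℕ) :
    srwLaw G μ n = μ.bind fun u => srwLaw G (PMF.pure u) n := by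
  induction n with
  | zero => simp [srwLaw]
  | succ n ih => simp only [srwLaw]; rw [ih, PMF.bind_bind]

theorem srwLaw_add (μ : PMF V) (m n : ℕ) :
    srwLaw G μ (m + n) = srwLaw G (srwLaw G μ m) n := by
  induction n with
  | zero => rfl
  | succ n ih => rw [← add_assoc]; simp only [srwLaw]; rw [ih]

theorem srwLaw_pure_add (m n : ℕ) (u v : V) :
    srwLaw G (PMF.pure u) (m + n) v =
      ∑' w, srwLaw G (PMF.pure u) m w * srwLaw G (PMF.pure w) n v := by
  rw [srwLaw_add, srwLaw_eq_bind, PMF.bind_apply]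

theorem degree_mul_srwStep (hdeg : ∀ v, 0 < G.degree v) (u v : V) :
    (G.degree u : ℝ≥0∞) * srwStep G u v = G.degree v * srwStep G v u := by
  classical
  have key : ∀ u v, (G.degree u : ℝ≥0∞) * srwStep G u v = if G.Adj u v then 1 else 0 := by
    intro u v
    have hne : (G.neighborFinset u).Nonempty := by
      rw [← Finset.card_pos, SimpleGraph.card_neighborFinset_eq_degree]; exact hdeg u
    rw [srwStep, dif_pos hne, PMF.uniformOfFinset_apply]
    simp only [SimpleGraph.mem_neighborFinset, SimpleGraph.card_neighborFinset_eq_degree]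
    split_ifs
    · exact ENNReal.mul_inv_cancel (by exact_mod_cast (hdeg u).ne') (ENNReal.natCast_ne_top _)
    · simp
  rw [key, key, G.adj_comm]

theorem degree_mul_srwLaw (hdeg : ∀ v, 0 < G.degree v) (n : ℕ) (u v : V) :
    (G.degree u : ℝ≥0∞) * srwLaw G (PMF.pure u) n v =
      G.degree v * srwLaw G (PMF.pure v) n u := by
  classical
  induction n generalizing u v with
  | zero =>
    simp only [srwLaw, PMF.pure_apply]
    by_cases h : u = v
    · subst h; rfl
    · simp [h, Ne.symm h]
  | succ n ih =>
    have hone : ∀ w, srwLaw G (PMF.pure w) 1 = srwStep G w := fun w => by simp [srwLaw]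
    -- One side splits off its last step and the other its first, so the two sums match term by
    -- term.
    rw [srwLaw_pure_add, add_comm n 1, srwLaw_pure_add, ← ENNReal.tsum_mul_left,
      ← ENNReal.tsum_mul_left]
    refine tsum_congr fun w => ?_
    rw [hone, hone, ← mul_assoc, ← mul_assoc, ih u w, ← degree_mul_srwStep G hdeg w v]
    ring

theorem hasSum_srwTransition (m n : ℕ) (u v : V) :
    HasSum (fun w => srwTransition G m u w * srwTransition G n w v)
      (srwTransition G (m + n) u v) := by
  have h := srwLaw_pure_add G m n u v
  have htop : ∑' w, srwLaw G (PMF.pure u) m w * srwLaw G (PMF.pure w) n v ≠ ∞ :=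
    h ▸ PMF.apply_ne_top _ _
  have := ENNReal.hasSum_toReal htop
  rw [← ENNReal.tsum_toReal_eq (ENNReal.ne_top_of_tsum_ne_top htop), ← h] at this
  simpa only [srwTransition, ENNReal.toReal_mul] using this

theorem degree_mul_srwTransition (hdeg : ∀ v, 0 < G.degree v) (n : ℕ) (u v : V) :
    (G.degree u : ℝ) * srwTransition G n u v = G.degree v * srwTransition G n v u := by
  simpa [srwTransition] using congrArg ENNReal.toReal (degree_mul_srwLaw G hdeg n u v)

/-- The transition kernel conjugated by the square root of the degree, which is symmetric. -/
noncomputable def symmTransition (n : ℕ) (u v : V) : ℝ :=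
  √(G.degree u) / √(G.degree v) * srwTransition G n u v

theorem isSymmSemigroup_symmTransition (hdeg : ∀ v, 0 < G.degree v) :
    IsSymmSemigroup (symmTransition G) := by
  have hs : ∀ v, 0 < √(G.degree v : ℝ) := fun v =>
    Real.sqrt_pos.2 (by exact_mod_cast hdeg v)
  refine ⟨fun n u v => mul_nonneg (by positivity) ENNReal.toReal_nonneg, fun n u v => ?_,
    fun m n u v => ?_⟩
  · have h := degree_mul_srwTransition G hdeg n u v
    have hu := hs u
    have hv := hs v
    rw [← Real.mul_self_sqrt (Nat.cast_nonneg (G.degree u)),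
      ← Real.mul_self_sqrt (Nat.cast_nonneg (G.degree v))] at h
    unfold symmTransition
    field_simp
    nlinarith [h]
  · refine ((hasSum_srwTransition G m n u v).mul_left
      (√(G.degree u : ℝ) / √(G.degree v : ℝ))).congr_fun fun w => ?_
    have hw := hs w
    unfold symmTransition
    field_simp

theorem srwReturnProb_eq_sum (D : Finset V) (hD : D.Nonempty) (k : ℕ) :
    srwReturnProb G D hD k = (D.card : ℝ)⁻¹ * ∑ u ∈ D, ∑ v ∈ D, srwTransition G k u v := by
  classical
  have h : ∀ v, srwLaw G (PMF.uniformOfFinset D hD) k v =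
      ∑ u ∈ D, (D.card : ℝ≥0∞)⁻¹ * srwLaw G (PMF.pure u) k v := by
    intro v
    rw [srwLaw_eq_bind, PMF.bind_apply, tsum_eq_sum (s := D)]
    · exact Finset.sum_congr rfl fun u hu => by rw [PMF.uniformOfFinset_apply_of_mem hD hu]
    · intro u hu
      rw [PMF.uniformOfFinset_apply_of_notMem hD hu, zero_mul]
  rw [srwReturnProb, PMF.toOuterMeasure_apply_finset,
    ENNReal.toReal_sum fun v _ => PMF.apply_ne_top _ _, Finset.sum_comm, Finset.mul_sum]
  refine Finset.sum_congr rfl fun v _ => ?_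
  rw [h, ← Finset.mul_sum, ENNReal.toReal_mul, ENNReal.toReal_sum fun u _ => PMF.apply_ne_top _ _]
  simp [srwTransition]

theorem div_degree_le_maxDegreeRatio (D : Finset V) (hD : D.Nonempty) {u v : V} (hu : u ∈ D)
    (hv : v ∈ D) : (G.degree u : ℝ) / G.degree v ≤ maxDegreeRatio G D hD :=
  Finset.le_sup' (fun p : V × V => (G.degree p.1 : ℝ) / (G.degree p.2 : ℝ))
    (Finset.mk_mem_product hu hv)

theorem one_le_maxDegreeRatio (hdeg : ∀ v, 0 < G.degree v) (D : Finset V) (hD : D.Nonempty) :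
    1 ≤ maxDegreeRatio G D hD := by
  obtain ⟨v, hv⟩ := hD
  have h := div_degree_le_maxDegreeRatio G D ⟨v, hv⟩ hv hv
  rwa [div_self (by exact_mod_cast (hdeg v).ne')] at h

theorem srwReturnProb_le_meanMass (hdeg : ∀ v, 0 < G.degree v) (D : Finset V) (hD : D.Nonempty)
    (k : ℕ) : srwReturnProb G D hD k ≤
      √(maxDegreeRatio G D hD) * meanMass (symmTransition G) D k := by
  have hq := isSymmSemigroup_symmTransition G hdeg
  rw [srwReturnProb_eq_sum, meanMass, mul_left_comm]
  refine mul_le_mul_of_nonneg_left ?_ (by positivity)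
  simp only [Finset.mul_sum]
  refine Finset.sum_le_sum fun u hu => Finset.sum_le_sum fun v hv => ?_
  have hsu : 0 < √(G.degree u : ℝ) := Real.sqrt_pos.2 (by exact_mod_cast hdeg u)
  have hsv : 0 < √(G.degree v : ℝ) := Real.sqrt_pos.2 (by exact_mod_cast hdeg v)
  calc srwTransition G k u v
      = √((G.degree v : ℝ) / G.degree u) * symmTransition G k u v := by
        rw [Real.sqrt_div (Nat.cast_nonneg _), symmTransition]; field_simp
    _ ≤ _ := mul_le_mul_of_nonneg_right
        (Real.sqrt_le_sqrt (div_degree_le_maxDegreeRatio G D hD hv hu)) (hq.nonneg _ _ _)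

end Walk

end Escape

theorem proposition3p1 (γ c α : ℝ) (hγ0 : 0 < γ) (hγ1 : γ ≤ 1) (hc : 0 < c)
    (hα : α = (1 - γ) / γ) :
    ∃ c₁ : ℝ, 0 < c₁ ∧
      ∀ (V : Type*) [Infinite V] (G : SimpleGraph V) [G.LocallyFinite],
        G.Connected → SatisfiesHK G γ c →
          ∀ (D : Finset V) (hD : D.Nonempty) (k : ℕ),
            srwReturnProb G D hD k ≤
              (maxDegreeRatio G D hD) ^ (1 / 2 : ℝ) *
                Real.exp (-c₁ * escapeExponent γ α D.card k) := by
  -- The factor c/2 is what remains after absorbing |D|, 2^(γ-1) pays for the dyadic overshoot, and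
  -- the minimum serves both cases for N.
  refine ⟨c / 2 * (2 ^ (γ - 1) * min 1 ((c / 2) ^ α)), by positivity, ?_⟩
  intro V _ G _ hG hHK D hD k
  have hdeg : ∀ v, 0 < G.degree v := fun v => hG.preconnected.degree_pos_of_nontrivial v
  have hM := one_le_maxDegreeRatio G hdeg D hD
  rw [← Real.sqrt_eq_rpow]
  -- At k = 0 the exponent vanishes, and it suffices that a probability is at most 1.
  rcases Nat.eq_zero_or_pos k with rfl | hk
  · have he : escapeExponent γ α D.card 0 = 0 := by
      simp [escapeExponent, Real.zero_rpow hγ0.ne']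
    rw [he, mul_zero, Real.exp_zero, mul_one]
    refine le_trans ?_ (Real.one_le_sqrt.2 hM)
    refine ENNReal.toReal_le_of_le_ofReal zero_le_one ?_
    rw [ENNReal.ofReal_one]
    rw [PMF.toOuterMeasure_apply_finset]
    exact (ENNReal.sum_le_tsum D).trans_eq (PMF.tsum_coe _)
  · refine (srwReturnProb_le_meanMass G hdeg D hD k).trans ?_
    gcongr
    refine (isSymmSemigroup_symmTransition G hdeg).meanMass_le_exp hγ0 hγ1 hc hα
      (fun v n hn => ?_) D hD k hk
    have hsv : √(G.degree v : ℝ) ≠ 0 := (Real.sqrt_pos.2 (by exact_mod_cast hdeg v)).ne'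
    rw [symmTransition, div_self hsv, one_mul]
    exact hHK v n hn
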